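/- Call a group $G$ \emph{recursively presented} if it has a presentation with finitely many generators and a recursively enumerable set of relators (words in the generators and their inverses). Call a finitely generated group $K$ \emph{algorithmically finite} if no algorithm writes out an infinite sequence of pairwise different elements of $K$; that is, for every finite generating family $g_1,\dots,g_k$ of $K$ there is no computable sequence $w_0,w_1,w_2,\dots$ of words in $g_1^{\pm1},\dots,g_k^{\pm1}$ representing pairwise different elements of $K$. \textbf{Theorem.} There exists an infinite, finitely generated, recursively presented, residually finite group $G$ such that for every positive integer $n$ the Cartesian power $G^n$ is algorithmically finite. Moreover, for every prime $p$, such a group $G$ can be chosen to have a normal subgroup $N$ isomorphic to the direct sum $\bigoplus_{i=1}^{\infty}\mathbb{Z}_p$ of countably infinitely many cyclic groups of order $p$, such that the extension splits: $G=H\ltimes N$ for some subgroup $H\le G$ (that is, $HN=G$ and $H\cap N=\{1\}$). -/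

import Mathlib

/-- The element of the group `G` written by the word `w` in the letters `g 0, …, g (k - 1)` and
their inverses: the letter `(i, true)` stands for `g i`, and `(i, false)` for `(g i)⁻¹`. -/
def wordValue {G : Type*} [Group G] {k : ℕ} (g : Fin k → G) (w : List (Fin k × Bool)) : G :=
  FreeGroup.lift g (FreeGroup.mk w)

/-- `G` has a presentation with finitely many generators and a recursively enumerable set of
relators, the relators being words in the generators and their inverses. -/
def IsRecursivelyPresented (G : Type*) [Group G] : Prop :=
  ∃ (k : ℕ) (R : Set (List (Fin k × Bool))), REPred (fun w => w ∈ R) ∧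
    Nonempty (PresentedGroup (FreeGroup.mk '' R) ≃* G)

/-- A finitely generated group is algorithmically finite if no algorithm writes out an infinite
sequence of pairwise different elements of it, where the elements are written as words in a
finite generating family (any one: the notion does not depend on the choice). -/
def AlgorithmicallyFinite (G : Type*) [Group G] : Prop :=
  Group.FG G ∧
    ∀ (k : ℕ) (g : Fin k → G), Subgroup.closure (Set.range g) = ⊤ →
      ¬ ∃ f : ℕ → List (Fin k × Bool), Computable f ∧
        Function.Injective (fun i => wordValue g (f i))

/-! Work in the free algebra on six letters over `ZMod p`. For each code `c` and tuple length `L`,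
search for two inputs whose outputs, read as `L`-tuples of algebra elements, agree in all low
degrees. For a total `c` the pigeonhole principle provides them, since each degree is a finite
space. The remaining homogeneous components of the differences become relators. Agreement is
demanded up to a degree beyond the index `q` of the relators, so only degrees `d > q` are needed: at
most `d` relators in degree `d`. By Golod–Shafarevich (`exists_monomial_notMem_idealPart`) the
quotient `A` stays infinite, yet every computable sequence of tuples repeats in it
(`exists_collision`).

The ideal is recursively enumerable because the search is effective. It is homogeneous, so the
degree filtration separates points and has finite quotients. A repetition among the powers of a
letter `x` makes `x` nilpotent, hence `1 + x` a unit. The group consists of the maps `y ↦ a + h * y`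
with `h` in the group generated by these units. An element of its `n`-th power is a `2 * n`-tuple
over `A`, computable from a word, so it is covered by the collisions. The translations form the
normal subgroup, a countably infinite vector space over `ZMod p`. -/

/-! ### Graded ideals of the free algebra and the Golod–Shafarevich bound. -/

section GolodShafarevich

variable (K : Type) [Field K]

/-- The free associative algebra on six generators, with words as a basis. -/
abbrev FreeAlg : Type := MonoidAlgebra K (FreeMonoid (Fin 6))

/-- The word `u` as an element of the free algebra. -/
noncomputable def monomial (u : List (Fin 6)) : FreeAlg K :=
  MonoidAlgebra.single (FreeMonoid.ofList u) 1

/-- The homogeneous elements of degree `n`. -/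
noncomputable def homog (n : ℕ) : Submodule K (FreeAlg K) :=
  Submodule.span K (monomial K '' {u | u.length = n})

/-- The projection to the homogeneous component of degree `n`. -/
noncomputable def component (n : ℕ) : FreeAlg K →ₗ[K] FreeAlg K :=
  (Finsupp.lsum K fun u : FreeMonoid (Fin 6) =>
    if u.toList.length = n then LinearMap.toSpanSingleton K (FreeAlg K) (monomial K u.toList)
    else 0) ∘ₗ (MonoidAlgebra.coeffLinearEquiv K).toLinearMap

variable {K}

theorem monomial_append (u v : List (Fin 6)) :
    monomial K (u ++ v) = monomial K u * monomial K v := by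
  simp [monomial, MonoidAlgebra.single_mul_single]

theorem monomial_nil : monomial K [] = 1 := rfl

theorem coeff_monomial (u v : List (Fin 6)) :
    (monomial K u).coeff (FreeMonoid.ofList v) = if u = v then 1 else 0 := by
  classical
  rw [monomial, MonoidAlgebra.coeff_single, Finsupp.single_apply]
  simp

theorem linearIndependent_monomial : LinearIndependent K (monomial K) := by
  have h := (Finsupp.basisSingleOne (R := K) (ι := FreeMonoid (Fin 6))).linearIndependent
  have h2 := h.map' (MonoidAlgebra.coeffLinearEquiv K).symm.toLinearMap
    (LinearEquiv.ker _)
  have h3 := h2.comp _ FreeMonoid.ofList.injective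
  exact h3

theorem span_monomial : Submodule.span K (Set.range (monomial K)) = ⊤ := by
  rw [eq_top_iff]
  rintro f -
  induction f using MonoidAlgebra.induction_linear with
  | zero => exact zero_mem _
  | add f g hf hg => exact add_mem hf hg
  | single u a =>
    have : MonoidAlgebra.single u a = a • monomial K u.toList := by simp [monomial]
    rw [this]
    exact Submodule.smul_mem _ _ (Submodule.subset_span ⟨_, rfl⟩)

theorem component_monomial (n : ℕ) (u : List (Fin 6)) :
    component K n (monomial K u) = if u.length = n then monomial K u else 0 := by
  simp only [component, monomial, LinearMap.comp_apply]
  have : (MonoidAlgebra.coeffLinearEquiv K).toLinearMap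
      (MonoidAlgebra.single (FreeMonoid.ofList u) (1 : K))
      = Finsupp.single (FreeMonoid.ofList u) 1 := rfl
  rw [this, Finsupp.lsum_single]
  split_ifs <;> simp_all

theorem monomial_mem_homog (u : List (Fin 6)) : monomial K u ∈ homog K u.length :=
  Submodule.subset_span ⟨u, rfl, rfl⟩

theorem mul_mem_homog {k d : ℕ} {f g : FreeAlg K} (hf : f ∈ homog K k) (hg : g ∈ homog K d) :
    f * g ∈ homog K (k + d) := by
  have h := Submodule.mul_mem_mul hf hg
  rw [homog, homog, Submodule.span_mul_span] at h
  refine Submodule.span_mono ?_ h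
  rintro _ ⟨_, ⟨u, rfl, rfl⟩, _, ⟨v, rfl, rfl⟩, rfl⟩
  exact ⟨u ++ v, by simp, monomial_append u v⟩

theorem component_eq_self {n : ℕ} {f : FreeAlg K} (hf : f ∈ homog K n) :
    component K n f = f := by
  induction hf using Submodule.span_induction with
  | mem x hx => obtain ⟨u, hu, rfl⟩ := hx; simp_all [component_monomial]
  | zero => simp
  | add f g _ _ hf hg => simp [hf, hg]
  | smul a f _ hf => simp [hf]

theorem component_eq_zero {m n : ℕ} (hmn : m ≠ n) {f : FreeAlg K} (hf : f ∈ homog K m) :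
    component K n f = 0 := by
  induction hf using Submodule.span_induction with
  | mem x hx => obtain ⟨u, hu, rfl⟩ := hx; simp_all [component_monomial]
  | zero => simp
  | add f g _ _ hf hg => simp [hf, hg]
  | smul a f _ hf => simp [hf]

theorem component_mem_homog (n : ℕ) (f : FreeAlg K) : component K n f ∈ homog K n := by
  have hf : f ∈ Submodule.span K (Set.range (monomial K)) := by simp [span_monomial]
  induction hf using Submodule.span_induction with
  | mem x hx =>
    obtain ⟨u, rfl⟩ := hx
    rw [component_monomial]
    split_ifs with h
    · exact h ▸ monomial_mem_homog u
    · exact zero_mem _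
  | zero => simp
  | add f g _ _ hf hg => rw [map_add]; exact add_mem hf hg
  | smul a f _ hf => rw [map_smul]; exact Submodule.smul_mem _ _ hf

theorem exists_sum_component (f : FreeAlg K) :
    ∃ N, ∀ M, N ≤ M → f = ∑ n ∈ Finset.range M, component K n f := by
  have hf : f ∈ Submodule.span K (Set.range (monomial K)) := by simp [span_monomial]
  induction hf using Submodule.span_induction with
  | mem x hx =>
    obtain ⟨u, rfl⟩ := hx
    refine ⟨u.length + 1, fun M hM => ?_⟩
    simp only [component_monomial]
    rw [Finset.sum_ite_eq, if_pos (by simp; omega)]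
  | zero => exact ⟨0, by simp⟩
  | add f g _ _ hf hg =>
    obtain ⟨N, hN⟩ := hf
    obtain ⟨N', hN'⟩ := hg
    refine ⟨max N N', fun M hM => ?_⟩
    simp only [map_add, Finset.sum_add_distrib]
    rw [← hN M (by omega), ← hN' M (by omega)]
  | smul a f _ hf =>
    obtain ⟨N, hN⟩ := hf
    refine ⟨N, fun M hM => ?_⟩
    simp only [map_smul, ← Finset.smul_sum]
    rw [← hN M hM]

theorem finite_words (n : ℕ) : {u : List (Fin 6) | u.length = n}.Finite :=
  List.finite_length_eq _ n

instance (n : ℕ) : FiniteDimensional K (homog K n) :=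
  FiniteDimensional.span_of_finite K ((finite_words n).image _)

theorem finrank_homog (n : ℕ) : Module.finrank K (homog K n) = 6 ^ n := by
  have h := linearIndependent_monomial (K := K)
  have h2 := h.comp (fun v : List.Vector (Fin 6) n => v.1) Subtype.val_injective
  have h3 := finrank_span_eq_card h2
  rw [card_vector, Fintype.card_fin] at h3
  have h4 : monomial K '' {u | u.length = n} =
      Set.range (monomial K ∘ fun v : List.Vector (Fin 6) n => v.1) :=
    Set.ext fun x => ⟨fun ⟨u, hu, hx⟩ => ⟨⟨u, hu⟩, hx⟩, fun ⟨u, hx⟩ => ⟨u.1, u.2, hx⟩⟩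
  rw [homog, h4, h3]

/-- The degree `n` part of the two-sided ideal generated by the homogeneous elements `r q d`
with `q < d`, where `d` is the degree of `r q d`. -/
noncomputable def idealPart (r : ℕ → ℕ → FreeAlg K) : ℕ → Submodule K (FreeAlg K)
  | 0 => ⊥
  | n + 1 =>
    (Finset.univ.sup fun i : Fin 6 =>
      (idealPart r n).map (LinearMap.mulRight K (monomial K [i]))) ⊔
    (Finset.range (n + 1)).sup fun k => (Finset.range (n + 1 - k)).sup fun q =>
      (homog K k).map (LinearMap.mulRight K (r q (n + 1 - k)))

variable {r : ℕ → ℕ → FreeAlg K}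

theorem mul_letter_mem_idealPart {n : ℕ} {f : FreeAlg K} (hf : f ∈ idealPart r n) (i : Fin 6) :
    f * monomial K [i] ∈ idealPart r (n + 1) := by
  rw [idealPart]
  refine Submodule.mem_sup_left ?_
  have := Finset.le_sup (f := fun i : Fin 6 =>
      (idealPart r n).map (LinearMap.mulRight K (monomial K [i]))) (Finset.mem_univ i)
  exact this ⟨f, hf, rfl⟩

theorem mul_relator_mem_idealPart {k d q : ℕ} (hq : q < d) {f : FreeAlg K} (hf : f ∈ homog K k) :
    f * r q d ∈ idealPart r (k + d) := by
  obtain ⟨d, rfl⟩ : ∃ e, d = e + 1 := ⟨d - 1, by omega⟩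
  rw [← add_assoc, idealPart]
  refine Submodule.mem_sup_right ?_
  have h1 := Finset.le_sup (f := fun j => (Finset.range (k + d + 1 - j)).sup fun q =>
      (homog K j).map (LinearMap.mulRight K (r q (k + d + 1 - j))))
      (s := Finset.range (k + d + 1)) (b := k) (by simp)
  have h2 := Finset.le_sup (f := fun q =>
      (homog K k).map (LinearMap.mulRight K (r q (k + d + 1 - k))))
      (s := Finset.range (k + d + 1 - k)) (b := q) (by simp; omega)
  refine (h2.trans h1) ⟨f, hf, ?_⟩
  simp [show k + d + 1 - k = d + 1 by omega]

theorem mul_monomial_mem_idealPart {n : ℕ} {f : FreeAlg K} (hf : f ∈ idealPart r n)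
    (v : List (Fin 6)) : f * monomial K v ∈ idealPart r (n + v.length) := by
  induction v using List.reverseRecOn with
  | nil => simpa [monomial_nil] using hf
  | append_singleton v i ih =>
    rw [monomial_append, ← mul_assoc, List.length_append, ← add_assoc]
    exact mul_letter_mem_idealPart ih i

theorem idealPart_le (hr : ∀ q d, r q d ∈ homog K d) (n : ℕ) : idealPart r n ≤ homog K n := by
  induction n with
  | zero => simp [idealPart]
  | succ n ih =>
    rw [idealPart]
    refine sup_le (Finset.sup_le fun i _ => ?_)
      (Finset.sup_le fun k hk => Finset.sup_le fun q hq => ?_)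
    · rintro _ ⟨f, hf, rfl⟩
      exact mul_mem_homog (ih hf) (monomial_mem_homog [i])
    · rintro _ ⟨f, hf, rfl⟩
      have := mul_mem_homog hf (hr q (n + 1 - k))
      rwa [show k + (n + 1 - k) = n + 1 by simp at hk; omega] at this

/-- `C` stands in for `V / W`. With `homog K n` and `idealPart r n` its dimension is that of the
degree `n` part of the quotient algebra. -/
theorem exists_complement {V W : Submodule K (FreeAlg K)} [FiniteDimensional K V] (h : W ≤ V) :
    ∃ C, V ≤ C ⊔ W ∧ FiniteDimensional K C ∧
      Module.finrank K C + Module.finrank K W = Module.finrank K V := by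
  obtain ⟨C, hC⟩ := Submodule.exists_isCompl W
  have h1 : W ⊔ C ⊓ V = V := by
    rw [← sup_inf_assoc_of_le C h, hC.sup_eq_top, top_inf_eq]
  have : FiniteDimensional K W := Submodule.finiteDimensional_of_le h
  have : FiniteDimensional K (C ⊓ V : Submodule K (FreeAlg K)) :=
    Submodule.finiteDimensional_of_le inf_le_right
  refine ⟨C ⊓ V, ?_, this, ?_⟩
  · rw [sup_comm, h1]
  · have h2 := Submodule.finrank_sup_add_finrank_inf_eq W (C ⊓ V)
    rw [h1, show W ⊓ (C ⊓ V) = ⊥ by rw [← inf_assoc, hC.inf_eq_bot, bot_inf_eq],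
      finrank_bot] at h2
    omega

theorem finrank_finset_sup_le {ι : Type*} (s : Finset ι) (W : ι → Submodule K (FreeAlg K))
    (h : ∀ i ∈ s, FiniteDimensional K (W i)) :
    FiniteDimensional K (s.sup W : Submodule K (FreeAlg K)) ∧
      Module.finrank K (s.sup W : Submodule K (FreeAlg K)) ≤
        ∑ i ∈ s, Module.finrank K (W i) := by
  classical
  induction s using Finset.induction_on with
  | empty => rw [Finset.sup_empty]; exact ⟨inferInstance, by simp⟩
  | insert a s ha ih =>
    obtain ⟨h1, h2⟩ := ih fun i hi => h i (Finset.mem_insert_of_mem hi)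
    have h3 := h a (Finset.mem_insert_self _ _)
    rw [Finset.sup_insert, Finset.sum_insert ha]
    exact ⟨inferInstance, (Submodule.finrank_add_le_finrank_add_finrank _ _).trans (by omega)⟩

/-- In the products `homog K k * r q d` it is enough to let the left factor run through `C k`: an
element of `idealPart r k` times a relator, whose words end in a letter, is already counted among
the products of `idealPart r n` with the six letters. -/
theorem finrank_idealPart_succ_le (hr : ∀ q d, r q d ∈ homog K d)
    (C : ℕ → Submodule K (FreeAlg K)) (hC : ∀ n, homog K n ≤ C n ⊔ idealPart r n)
    (hfin : ∀ n, FiniteDimensional K (C n)) (n : ℕ) :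
    Module.finrank K (idealPart r (n + 1)) ≤ 6 * Module.finrank K (idealPart r n) +
      ∑ k ∈ Finset.range (n + 1), (n + 1 - k) * Module.finrank K (C k) := by
  have hfd : ∀ n, FiniteDimensional K (idealPart r n) := fun n =>
    Submodule.finiteDimensional_of_le (idealPart_le hr n)
  set A : Submodule K (FreeAlg K) := Finset.univ.sup fun i : Fin 6 =>
      (idealPart r n).map (LinearMap.mulRight K (monomial K [i])) with hA
  set B : Submodule K (FreeAlg K) := (Finset.range (n + 1)).sup fun k =>
      (Finset.range (n + 1 - k)).sup fun q =>
      (C k).map (LinearMap.mulRight K (r q (n + 1 - k))) with hB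
  obtain ⟨hA1, hA2⟩ := finrank_finset_sup_le (K := K) Finset.univ (fun i : Fin 6 =>
      (idealPart r n).map (LinearMap.mulRight K (monomial K [i]))) (fun i _ => inferInstance)
  have hB0 := fun k => finrank_finset_sup_le (K := K) (Finset.range (n + 1 - k)) (fun q =>
      (C k).map (LinearMap.mulRight K (r q (n + 1 - k)))) (fun i _ => inferInstance)
  obtain ⟨hB1, hB2⟩ := finrank_finset_sup_le (K := K) (Finset.range (n + 1)) _
    (fun k _ => (hB0 k).1)
  rw [← hA] at hA1 hA2
  rw [← hB] at hB1 hB2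
  have hle : idealPart r (n + 1) ≤ A ⊔ B := by
    rw [idealPart]
    refine sup_le le_sup_left (Finset.sup_le fun k hk => Finset.sup_le fun q hq => ?_)
    refine (Submodule.map_mono (hC k)).trans ?_
    rw [Submodule.map_sup]
    refine sup_le ?_ ?_
    · refine le_trans ?_ le_sup_right
      rw [hB]
      refine le_trans ?_ (Finset.le_sup hk)
      exact Finset.le_sup (f := fun q => (C k).map (LinearMap.mulRight K (r q (n + 1 - k)))) hq
    · refine le_trans ?_ le_sup_left
      rintro _ ⟨f, hf, rfl⟩
      obtain ⟨d, hd⟩ : ∃ d, n + 1 - k = d + 1 := ⟨n - k, by simp at hk; omega⟩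
      have hg := hr q (n + 1 - k)
      rw [LinearMap.mulRight_apply]
      rw [hd] at hg ⊢
      rw [show n = k + d by omega] at hA
      generalize r q (d + 1) = g at hg
      induction hg using Submodule.span_induction with
      | mem x hx =>
        obtain ⟨u, hu, rfl⟩ := hx
        obtain ⟨v, i, rfl⟩ : ∃ v i, u = v ++ [i] := by
          rcases List.eq_nil_or_concat u with rfl | ⟨v, i, h⟩
          · simp at hu
          · exact ⟨v, i, by simpa using h⟩
        rw [monomial_append, ← mul_assoc, hA]
        have h1 := mul_monomial_mem_idealPart hf v
        simp only [Set.mem_ofPred_eq, List.length_append, List.length_singleton,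
          add_left_inj] at hu
        rw [hu] at h1
        exact Finset.le_sup (f := fun i : Fin 6 =>
          (idealPart r (k + d)).map (LinearMap.mulRight K (monomial K [i])))
          (Finset.mem_univ i) ⟨_, h1, rfl⟩
      | zero => simp
      | add g h _ _ hg hh => rw [mul_add]; exact add_mem hg hh
      | smul a g _ hg => rw [mul_smul_comm]; exact Submodule.smul_mem _ _ hg
  refine (Submodule.finrank_mono hle).trans
    ((Submodule.finrank_add_le_finrank_add_finrank _ _).trans (add_le_add ?_ ?_))
  · refine hA2.trans ?_
    refine (Finset.sum_le_sum fun i _ => Submodule.finrank_map_le _ _).trans ?_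
    simp
  · refine hB2.trans (Finset.sum_le_sum fun k _ => (hB0 k).2.trans ?_)
    refine (Finset.sum_le_sum fun i _ => Submodule.finrank_map_le _ _).trans ?_
    simp

theorem pos_of_recurrence (a : ℕ → ℕ) (h0 : 0 < a 0)
    (h : ∀ n, 6 * a n ≤ a (n + 1) + ∑ k ∈ Finset.range (n + 1), (n + 1 - k) * a k) (n : ℕ) :
    0 < a n := by
  -- The bound by `4 * a n` turns the recurrence into `a (n + 1) ≥ 2 * a n`. This doubling restores
  -- both bounds, since the weighted sum grows by the next plain sum.
  have key : ∀ n, 0 < a n ∧ ∑ k ∈ Finset.range (n + 1), a k ≤ 2 * a n ∧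
      ∑ k ∈ Finset.range (n + 1), (n + 1 - k) * a k ≤ 4 * a n := by
    intro n
    induction n with
    | zero => simp; omega
    | succ n ih =>
      obtain ⟨h1, h2, h3⟩ := ih
      have h4 := h n
      have h5 : ∑ k ∈ Finset.range (n + 1 + 1), (n + 1 + 1 - k) * a k =
          ∑ k ∈ Finset.range (n + 1), (n + 1 - k) * a k +
            ∑ k ∈ Finset.range (n + 1 + 1), a k := by
        rw [Finset.sum_range_succ, Finset.sum_range_succ _ (n + 1), ← add_assoc,
          ← Finset.sum_add_distrib]
        congr 1
        · refine Finset.sum_congr rfl fun k hk => ?_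
          simp only [Finset.mem_range] at hk
          rw [show n + 1 + 1 - k = n + 1 - k + 1 by omega]
          ring
        · simp
      rw [h5, Finset.sum_range_succ a (n + 1)]
      omega
  exact (key n).1

/-- **Golod–Shafarevich**: if the ideal has at most `d` generators in each degree `d`, then in
each degree some word stays outside. -/
theorem exists_monomial_notMem_idealPart (hr : ∀ q d, r q d ∈ homog K d) (n : ℕ) :
    ∃ u : List (Fin 6), u.length = n ∧ monomial K u ∉ idealPart r n := by
  choose C hC hfin hrank using fun n => exists_complement (idealPart_le hr n)
  -- Subtracting the dimension bound for the ideal from `6 ^ (n + 1) = 6 * 6 ^ n` gives the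
  -- recurrence for the complements.
  have hpos := pos_of_recurrence (fun n => Module.finrank K (C n))
    (by have := hrank 0; rw [finrank_homog, idealPart, finrank_bot] at this; omega)
    (fun n => by
      have h1 := finrank_idealPart_succ_le hr C hC hfin n
      have h2 := hrank n
      have h3 := hrank (n + 1)
      rw [finrank_homog] at h2 h3
      rw [pow_succ] at h3
      omega) n
  by_contra! hcon
  have : homog K n = idealPart r n := by
    refine le_antisymm (Submodule.span_le.2 ?_) (idealPart_le hr n)
    rintro _ ⟨u, hu, rfl⟩
    exact hcon u hu
  have h2 := hrank n
  rw [this] at h2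
  omega

end GolodShafarevich

/-! ### Computable representation of the algebra, and the enumeration of the relators. -/

section Enumeration

/-- A list of words, standing for the sum of these words in the free algebra. -/
abbrev WordSum : Type := List (List (Fin 6))

namespace WordSum

/-- The element of the free algebra written by a list of words. -/
noncomputable def eval (K : Type) [Field K] (P : WordSum) : FreeAlg K :=
  (P.map (monomial K)).sum

/-- Two lists of words contain every word equally often modulo `p`. -/
def Equiv (p : ℕ) (P Q : WordSum) : Prop :=
  ∀ u ∈ P ++ Q, P.count u % p = Q.count u % p

/-- Product of sums of words. -/
def mul (P Q : WordSum) : WordSum := P.flatMap fun u => Q.map fun v => u ++ v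

/-- Negative of a sum of words in characteristic `p`. -/
def neg (p : ℕ) (P : WordSum) : WordSum := (List.range (p - 1)).flatMap fun _ => P

/-- The homogeneous component of degree `d`. -/
def part (d : ℕ) (P : WordSum) : WordSum := P.filter fun u => u.length = d

/-- The terms of degree at most `d`. -/
def truncate (d : ℕ) (P : WordSum) : WordSum := P.filter fun u => u.length ≤ d

section Eval

variable {K : Type} [Field K]

theorem eval_nil : eval K [] = 0 := rfl

theorem eval_singleton (u : List (Fin 6)) : eval K [u] = monomial K u := by simp [eval]

theorem eval_append (P Q : WordSum) : eval K (P ++ Q) = eval K P + eval K Q := by simp [eval]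

theorem eval_cons (u : List (Fin 6)) (P : WordSum) :
    eval K (u :: P) = monomial K u + eval K P := by simp [eval]

theorem eval_flatMap {ι : Type*} (σ : List ι) (f : ι → WordSum) :
    eval K (σ.flatMap f) = (σ.map fun i => eval K (f i)).sum := by
  induction σ with
  | nil => rfl
  | cons a σ ih => rw [List.flatMap_cons, eval_append, ih, List.map_cons, List.sum_cons]

theorem eval_mul (P Q : WordSum) : eval K (mul P Q) = eval K P * eval K Q := by
  rw [mul, eval_flatMap, eval, ← List.sum_map_mul_right]
  congr 1
  refine List.map_congr_left fun u _ => ?_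
  rw [eval, List.map_map, eval, ← List.sum_map_mul_left]
  simp only [Function.comp_def, monomial_append]

theorem eval_neg (p : ℕ) [Fact p.Prime] (P : WordSum) :
    eval (ZMod p) (neg p P) = -eval (ZMod p) P := by
  rw [neg, eval_flatMap, List.map_const', List.length_range, List.sum_replicate,
    ← Nat.cast_smul_eq_nsmul (ZMod p), Nat.cast_sub (Fact.out : p.Prime).one_le]
  simp

theorem eval_part (d : ℕ) (P : WordSum) : eval K (part d P) = component K d (eval K P) := by
  induction P with
  | nil => simp [part, eval]
  | cons u P ih =>
    rw [eval_cons, map_add, ← ih, component_monomial, part, part, List.filter_cons]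
    split_ifs <;> simp_all [eval]

theorem coeff_eval (P : WordSum) (u : List (Fin 6)) :
    (eval K P).coeff (FreeMonoid.ofList u) = (P.count u : K) := by
  induction P with
  | nil => simp [eval]
  | cons v P ih =>
    rw [eval_cons, MonoidAlgebra.coeff_add, Finsupp.add_apply, ih, coeff_monomial,
      List.count_cons]
    simp only [beq_iff_eq]
    split_ifs <;> simp [add_comm]

/-- Words outside `P ++ Q` have count zero on both sides, so a finite check decides equality in the
free algebra. -/
theorem equiv_iff (p : ℕ) [Fact p.Prime] (P Q : WordSum) :
    Equiv p P Q ↔ eval (ZMod p) P = eval (ZMod p) Q := by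
  constructor
  · intro h
    refine MonoidAlgebra.ext (Finsupp.ext fun u => ?_)
    have h1 := coeff_eval (K := ZMod p) P u.toList
    have h2 := coeff_eval (K := ZMod p) Q u.toList
    rw [FreeMonoid.ofList_toList] at h1 h2
    rw [h1, h2, ZMod.natCast_eq_natCast_iff']
    by_cases hu : u.toList ∈ P ++ Q
    · exact h _ hu
    · simp only [List.mem_append, not_or] at hu
      rw [List.count_eq_zero_of_not_mem hu.1, List.count_eq_zero_of_not_mem hu.2]
  · intro h u _
    rw [← ZMod.natCast_eq_natCast_iff', ← coeff_eval, ← coeff_eval, h]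

theorem eval_truncate (d : ℕ) (P : WordSum) :
    eval K (truncate d P) = ∑ k ∈ Finset.range (d + 1), component K k (eval K P) := by
  induction P with
  | nil => simp [truncate, eval]
  | cons u P ih =>
    simp only [eval_cons, map_add, Finset.sum_add_distrib]
    rw [← ih, truncate, truncate, List.filter_cons]
    simp only [component_monomial]
    rw [Finset.sum_ite_eq]
    simp only [Finset.mem_range, decide_eq_true_eq, Order.lt_add_one_iff]
    split_ifs <;> simp [eval_cons]

/-- Every scalar of a prime field is a natural number, so repetition of words replaces coefficients.
-/
theorem exists_eval_eq (p : ℕ) [Fact p.Prime] (f : FreeAlg (ZMod p)) :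
    ∃ P, eval (ZMod p) P = f := by
  have hf : f ∈ Submodule.span (ZMod p) (Set.range (monomial (ZMod p))) := by
    simp [span_monomial]
  induction hf using Submodule.span_induction with
  | mem x hx => obtain ⟨u, rfl⟩ := hx; exact ⟨[u], eval_singleton u⟩
  | zero => exact ⟨[], rfl⟩
  | add f g _ _ hf hg =>
    obtain ⟨P, rfl⟩ := hf
    obtain ⟨Q, rfl⟩ := hg
    exact ⟨P ++ Q, eval_append P Q⟩
  | smul a f _ hf =>
    obtain ⟨P, rfl⟩ := hf
    refine ⟨(List.range a.val).flatMap fun _ => P, ?_⟩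
    rw [eval_flatMap, List.map_const', List.length_range, List.sum_replicate,
      ← Nat.cast_smul_eq_nsmul (ZMod p), ZMod.natCast_zmod_val]

end Eval

end WordSum

open Nat.Partrec (Code)

/-- The list of sums of words that the code `c` yields within `s` steps on input `i`. -/
def output (c s i : ℕ) : List WordSum :=
  -- The default covers undecodable output and a computation that has not halted; `IsCollision`
  -- excludes the latter by its `isSome` tests.
  ((Code.evaln s (Denumerable.ofNat Code c) i).bind Encodable.decode).getD []

/-- The code `c` halts within `s` steps on the inputs `i ≠ j`, and the first `L` sums of words in
the two outputs agree up to degree `(e, L)`, where `e = (c, L)` and `t = (i, (j, s))`. -/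
def IsCollision (p e t : ℕ) : Prop :=
  t.unpair.1 ≠ t.unpair.2.unpair.1 ∧
  (Code.evaln t.unpair.2.unpair.2 (Denumerable.ofNat Code e.unpair.1) t.unpair.1).isSome ∧
  (Code.evaln t.unpair.2.unpair.2 (Denumerable.ofNat Code e.unpair.1)
    t.unpair.2.unpair.1).isSome ∧
  -- With `e = (c, L)`, the cut-off `(e, L)` exceeds every relator index `(e, l)` with `l < L`.
  ∀ l < e.unpair.2, WordSum.Equiv p
    (((output e.unpair.1 t.unpair.2.unpair.2 t.unpair.1).getD l []).truncate (e.pair e.unpair.2))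
    (((output e.unpair.1 t.unpair.2.unpair.2 t.unpair.2.unpair.1).getD l []).truncate (e.pair e.unpair.2))

/-- `t` is the first collision for `e`. -/
def IsFirstCollision (p e t : ℕ) : Prop :=
  IsCollision p e t ∧ ∀ t' < t, ¬ IsCollision p e t'

/-- The relator of degree `d` with index `q = (e, l)` that stems from the collision `t`. -/
def collisionRelator (p q d t : ℕ) : WordSum :=
  ((output q.unpair.1.unpair.1 t.unpair.2.unpair.2 t.unpair.1).getD q.unpair.2 []).part d ++
  (((output q.unpair.1.unpair.1 t.unpair.2.unpair.2 t.unpair.2.unpair.1).getD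
    q.unpair.2 []).part d).neg p

/-- The index `(u, v, q, d, t)` describes an element of the ideal. -/
def IsGeneratorIndex (p : ℕ) (s : List (Fin 6) × List (Fin 6) × ℕ × ℕ × ℕ) : Prop :=
  -- The condition `q < d` leaves at most `d` relators in degree `d`; taking the first collision
  -- makes `t` unique.
  s.2.2.1 < s.2.2.2.1 ∧ IsFirstCollision p s.2.2.1.unpair.1 s.2.2.2.2

open Classical in
/-- The element of the ideal with index `(u, v, q, d, t)`. -/
noncomputable def generator (p : ℕ) (s : List (Fin 6) × List (Fin 6) × ℕ × ℕ × ℕ) : WordSum :=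
  if IsGeneratorIndex p s then
    WordSum.mul (WordSum.mul [s.1] (collisionRelator p s.2.2.1 s.2.2.2.1 s.2.2.2.2)) [s.2.1]
  else []

/-! ### Primitive recursiveness of the enumeration. -/

section Primrec

open Primrec

variable {α β : Type*} [Primcodable α] [Primcodable β]

theorem PrimrecRel.rePred_exists {R : α → β → Prop} (hR : PrimrecRel R) :
    REPred fun a => ∃ b, R a b := by
  classical
  have h1 : Primrec₂ fun (a : α) (n : ℕ) =>
      (Encodable.decode (α := β) n).bind fun b => if R a b then some () else none := by
    refine Primrec.option_bind (Primrec.decode.comp Primrec.snd) ?_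
    exact Primrec.ite (hR.comp (Primrec.fst.comp Primrec.fst) Primrec.snd)
      (Primrec.const _) (Primrec.const _)
  refine (Partrec.rfindOpt h1.to_comp).dom_re.of_eq fun a => ?_
  rw [Nat.rfindOpt_dom]
  constructor
  · rintro ⟨n, x, hx⟩
    simp only [Option.mem_def, Option.bind_eq_some_iff] at hx
    obtain ⟨b, -, hb⟩ := hx
    refine ⟨b, ?_⟩
    by_contra h
    simp [h] at hb
  · rintro ⟨b, hb⟩
    exact ⟨Encodable.encode b, (), by simp [hb]⟩

theorem primrec_count : Primrec₂ fun (P : WordSum) (u : List (Fin 6)) => P.count u := by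
  have h : PrimrecRel fun (b a : List (Fin 6)) => b = a := Primrec.eq
  have h2 := Primrec.list_length.comp₂ (PrimrecRel.listFilter h)
  refine h2.of_eq fun P u => ?_
  rw [List.count, List.countP_eq_length_filter]
  congr 2
  ext b
  rw [beq_eq_decide]

theorem primrecRel_equiv (p : ℕ) : PrimrecRel (WordSum.Equiv p) := by
  have h : PrimrecRel fun (u : List (Fin 6)) (x : WordSum × WordSum) =>
      x.1.count u % p = x.2.count u % p :=
    Primrec.eq.comp
      (Primrec.nat_mod.comp (primrec_count.comp (fst.comp snd) fst) (Primrec.const p))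
      (Primrec.nat_mod.comp (primrec_count.comp (snd.comp snd) fst) (Primrec.const p))
  have h2 := PrimrecRel.forall_mem_list h
  exact h2.comp (Primrec.list_append.comp fst snd) Primrec.id

theorem primrec_mul : Primrec₂ WordSum.mul :=
  Primrec.list_flatMap fst (Primrec.list_map (snd.comp fst)
    (Primrec.list_append.comp (snd.comp fst) snd))

theorem primrec_neg (p : ℕ) : Primrec (WordSum.neg p) :=
  Primrec.list_flatMap (Primrec.const _) fst

theorem primrec_part : Primrec₂ fun (P : WordSum) (d : ℕ) => P.part d := by
  have h : PrimrecRel fun (u : List (Fin 6)) (d : ℕ) => u.length = d :=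
    Primrec.eq.comp (Primrec.list_length.comp fst) snd
  exact PrimrecRel.listFilter h

theorem primrec_truncate : Primrec₂ fun (P : WordSum) (d : ℕ) => P.truncate d := by
  have h : PrimrecRel fun (u : List (Fin 6)) (d : ℕ) => u.length ≤ d :=
    Primrec.nat_le.comp (Primrec.list_length.comp fst) snd
  exact PrimrecRel.listFilter h

theorem primrec_unpair_fst {f : α → ℕ} (hf : Primrec f) : Primrec fun a => (f a).unpair.1 :=
  fst.comp (Primrec.unpair.comp hf)

theorem primrec_unpair_snd {f : α → ℕ} (hf : Primrec f) : Primrec fun a => (f a).unpair.2 :=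
  snd.comp (Primrec.unpair.comp hf)

theorem primrec_evaln {c s i : α → ℕ} (hc : Primrec c) (hs : Primrec s) (hi : Primrec i) :
    Primrec fun a => Code.evaln (s a) (Denumerable.ofNat Code (c a)) (i a) :=
  Code.primrec_evaln.comp ((hs.pair ((Primrec.ofNat Code).comp hc)).pair hi)

theorem primrec_output {c s i : α → ℕ} (hc : Primrec c) (hs : Primrec s) (hi : Primrec i) :
    Primrec fun a => output (c a) (s a) (i a) :=
  Primrec.option_getD.comp (Primrec.option_bind (primrec_evaln hc hs hi)
    (Primrec.decode.comp snd)) (Primrec.const [])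

theorem primrecRel_isCollision (p : ℕ) : PrimrecRel (IsCollision p) := by
  have he : Primrec fun x : ℕ × ℕ => x.1.unpair.1 := primrec_unpair_fst fst
  have hi : Primrec fun x : ℕ × ℕ => x.2.unpair.1 := primrec_unpair_fst snd
  have hj : Primrec fun x : ℕ × ℕ => x.2.unpair.2.unpair.1 :=
    primrec_unpair_fst (primrec_unpair_snd snd)
  have hs : Primrec fun x : ℕ × ℕ => x.2.unpair.2.unpair.2 :=
    primrec_unpair_snd (primrec_unpair_snd snd)
  have hN : Primrec fun x : ℕ × ℕ => x.1.pair x.1.unpair.2 :=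
    Primrec₂.natPair.comp fst (primrec_unpair_snd fst)
  have h4 : PrimrecRel fun (l : ℕ) (x : ℕ × ℕ) => WordSum.Equiv p
      (((output x.1.unpair.1 x.2.unpair.2.unpair.2 x.2.unpair.1).getD l []).truncate
        (x.1.pair x.1.unpair.2))
      (((output x.1.unpair.1 x.2.unpair.2.unpair.2 x.2.unpair.2.unpair.1).getD l
        []).truncate (x.1.pair x.1.unpair.2)) :=
    (primrecRel_equiv p).comp
      (primrec_truncate.comp ((Primrec.list_getD []).comp
        (primrec_output (he.comp snd) (hs.comp snd) (hi.comp snd)) fst) (hN.comp snd))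
      (primrec_truncate.comp ((Primrec.list_getD []).comp
        (primrec_output (he.comp snd) (hs.comp snd) (hj.comp snd)) fst) (hN.comp snd))
  have h5 := ((PrimrecRel.forall_mem_list h4).comp (f := fun x : ℕ × ℕ =>
    List.range x.1.unpair.2) (g := id)
    (Primrec.list_range.comp (primrec_unpair_snd fst)) Primrec.id)
  simp only [List.mem_range, id] at h5
  have h1 : PrimrecPred fun x : ℕ × ℕ => x.2.unpair.1 ≠ x.2.unpair.2.unpair.1 :=
    (Primrec.eq.comp hi hj).not
  have hsome : PrimrecPred fun b : Bool => b = true := Primrec.eq.comp Primrec.id (Primrec.const _)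
  have h2 := hsome.comp (Primrec.option_isSome.comp (primrec_evaln he hs hi))
  have h3 := hsome.comp (Primrec.option_isSome.comp (primrec_evaln he hs hj))
  exact h1.and (h2.and (h3.and h5))

theorem primrecRel_isFirstCollision (p : ℕ) : PrimrecRel (IsFirstCollision p) := by
  have h1 : PrimrecRel fun (t' e : ℕ) => ¬ IsCollision p e t' :=
    ((primrecRel_isCollision p).comp snd fst).not
  have h2 := (PrimrecRel.forall_lt h1).comp (f := fun x : ℕ × ℕ => x.2) (g := fun x => x.1)
    snd fst
  exact PrimrecPred.and (primrecRel_isCollision p) h2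

theorem primrec_collisionRelator (p : ℕ) :
    Primrec fun x : ℕ × ℕ × ℕ => collisionRelator p x.1 x.2.1 x.2.2 := by
  have hc : Primrec fun x : ℕ × ℕ × ℕ => x.1.unpair.1.unpair.1 :=
    primrec_unpair_fst (primrec_unpair_fst fst)
  have hl : Primrec fun x : ℕ × ℕ × ℕ => x.1.unpair.2 := primrec_unpair_snd fst
  have ht : Primrec fun x : ℕ × ℕ × ℕ => x.2.2 := snd.comp snd
  have hd : Primrec fun x : ℕ × ℕ × ℕ => x.2.1 := fst.comp snd
  have hi := primrec_unpair_fst ht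
  have hj := primrec_unpair_fst (primrec_unpair_snd ht)
  have hs := primrec_unpair_snd (primrec_unpair_snd ht)
  exact Primrec.list_append.comp
    (primrec_part.comp ((Primrec.list_getD []).comp (primrec_output hc hs hi) hl) hd)
    ((primrec_neg p).comp
      (primrec_part.comp ((Primrec.list_getD []).comp (primrec_output hc hs hj) hl) hd))

-- Whether a given `t` is a first collision is settled by step-bounded simulation and a bounded
-- search. Hence the generators are listed without deciding whether `e` has a collision at all.
open Classical in
theorem primrec_generator (p : ℕ) : Primrec (generator p) := by
  have hu : Primrec fun s : List (Fin 6) × List (Fin 6) × ℕ × ℕ × ℕ => s.1 := fst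
  have hv : Primrec fun s : List (Fin 6) × List (Fin 6) × ℕ × ℕ × ℕ => s.2.1 := fst.comp snd
  have hw : Primrec fun s : List (Fin 6) × List (Fin 6) × ℕ × ℕ × ℕ => s.2.2 := snd.comp snd
  have hsing : Primrec fun u : List (Fin 6) => [u] :=
    Primrec.list_cons.comp Primrec.id (Primrec.const [])
  have h1 : PrimrecPred (IsGeneratorIndex p) :=
    (Primrec.nat_lt.comp (fst.comp hw) (fst.comp (snd.comp hw))).and
      ((primrecRel_isFirstCollision p).comp (primrec_unpair_fst (fst.comp hw))
        (snd.comp (snd.comp hw)))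
  exact Primrec.ite h1 (primrec_mul.comp (primrec_mul.comp (hsing.comp hu)
    ((primrec_collisionRelator p).comp hw)) (hsing.comp hv)) (Primrec.const [])

end Primrec

/-- A sum of words lies in the ideal iff some list of generators sums to it; this is a
recursively enumerable condition. -/
theorem primrecRel_equiv_flatMap_generator (p : ℕ) :
    PrimrecRel fun (P : WordSum) (σ : List (List (Fin 6) × List (Fin 6) × ℕ × ℕ × ℕ)) =>
      WordSum.Equiv p P (σ.flatMap (generator p)) :=
  (primrecRel_equiv p).comp Primrec.fst
    (Primrec.list_flatMap Primrec.snd ((primrec_generator p).comp Primrec.snd))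

end Enumeration

/-! ### The relator ideal: homogeneity, properness in every degree, collisions. -/

section RelatorIdeal

open Nat.Partrec (Code)

theorem IsFirstCollision.unique {p e t t' : ℕ} (h : IsFirstCollision p e t)
    (h' : IsFirstCollision p e t') : t = t' := by
  rcases lt_trichotomy t t' with hlt | heq | hlt
  · exact absurd h.1 (h'.2 t hlt)
  · exact heq
  · exact absurd h'.1 (h.2 t' hlt)

theorem exists_isFirstCollision {p e : ℕ} (h : ∃ t, IsCollision p e t) :
    ∃ t, IsFirstCollision p e t := by
  classical
  exact ⟨Nat.find h, Nat.find_spec h, fun t' ht' => Nat.find_min h ht'⟩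

variable (p : ℕ) [Fact p.Prime]

open Classical in
/-- The relator of degree `d` with index `q`. -/
noncomputable def relator (q d : ℕ) : FreeAlg (ZMod p) :=
  if h : ∃ t, IsFirstCollision p q.unpair.1 t then
    WordSum.eval (ZMod p) (collisionRelator p q d h.choose)
  else 0

variable {p}

theorem eval_collisionRelator (q d t : ℕ) : WordSum.eval (ZMod p) (collisionRelator p q d t) =
    component (ZMod p) d
      (WordSum.eval (ZMod p)
        ((output q.unpair.1.unpair.1 t.unpair.2.unpair.2 t.unpair.1).getD q.unpair.2 []) -
      WordSum.eval (ZMod p)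
        ((output q.unpair.1.unpair.1 t.unpair.2.unpair.2 t.unpair.2.unpair.1).getD
          q.unpair.2 [])) := by
  rw [collisionRelator, WordSum.eval_append, WordSum.eval_neg, WordSum.eval_part,
    WordSum.eval_part, map_sub, sub_eq_add_neg]

theorem relator_eq {q t : ℕ} (h : IsFirstCollision p q.unpair.1 t) (d : ℕ) :
    relator p q d = WordSum.eval (ZMod p) (collisionRelator p q d t) := by
  have h1 : ∃ t, IsFirstCollision p q.unpair.1 t := ⟨t, h⟩
  rw [relator, dif_pos h1, h1.choose_spec.unique h]

theorem relator_mem_homog (q d : ℕ) : relator p q d ∈ homog (ZMod p) d := by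
  rw [relator]
  split_ifs
  · rw [eval_collisionRelator]
    exact component_mem_homog _ _
  · exact zero_mem _

theorem eval_generator_of_index {s : List (Fin 6) × List (Fin 6) × ℕ × ℕ × ℕ}
    (h : IsGeneratorIndex p s) : WordSum.eval (ZMod p) (generator p s) =
      monomial (ZMod p) s.1 * relator p s.2.2.1 s.2.2.2.1 * monomial (ZMod p) s.2.1 := by
  rw [generator, if_pos h, WordSum.eval_mul, WordSum.eval_mul, WordSum.eval_singleton,
    WordSum.eval_singleton, relator_eq h.2]

theorem eval_generator_of_not_index {s : List (Fin 6) × List (Fin 6) × ℕ × ℕ × ℕ}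
    (h : ¬ IsGeneratorIndex p s) : WordSum.eval (ZMod p) (generator p s) = 0 := by
  rw [generator, if_neg h, WordSum.eval_nil]

theorem monomial_mul_eval_generator (w : List (Fin 6))
    (s : List (Fin 6) × List (Fin 6) × ℕ × ℕ × ℕ) :
    monomial (ZMod p) w * WordSum.eval (ZMod p) (generator p s) =
      WordSum.eval (ZMod p) (generator p (w ++ s.1, s.2)) := by
  by_cases h : IsGeneratorIndex p s
  · rw [eval_generator_of_index h, eval_generator_of_index (s := (w ++ s.1, s.2)) h,
      monomial_append]
    simp only [mul_assoc]
  · rw [eval_generator_of_not_index h, eval_generator_of_not_index (s := (w ++ s.1, s.2)) h,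
      mul_zero]

theorem eval_generator_mul_monomial (w : List (Fin 6))
    (s : List (Fin 6) × List (Fin 6) × ℕ × ℕ × ℕ) :
    WordSum.eval (ZMod p) (generator p s) * monomial (ZMod p) w =
      WordSum.eval (ZMod p) (generator p (s.1, s.2.1 ++ w, s.2.2)) := by
  by_cases h : IsGeneratorIndex p s
  · rw [eval_generator_of_index h, eval_generator_of_index (s := (s.1, s.2.1 ++ w, s.2.2)) h,
      monomial_append]
    simp only [mul_assoc]
  · rw [eval_generator_of_not_index h,
      eval_generator_of_not_index (s := (s.1, s.2.1 ++ w, s.2.2)) h, zero_mul]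

variable (p)

/-- The ideal of all relations, as the set of sums of generators. -/
noncomputable def relatorIdeal : Ideal (FreeAlg (ZMod p)) where
  -- Repetitions in `σ` supply the coefficients. Closure under multiplication comes from lengthening
  -- the outer words `u` and `v` of the generators.
  carrier := {f | ∃ σ : List (List (Fin 6) × List (Fin 6) × ℕ × ℕ × ℕ),
    f = WordSum.eval (ZMod p) (σ.flatMap (generator p))}
  zero_mem' := ⟨[], rfl⟩
  add_mem' := by
    rintro _ _ ⟨σ, rfl⟩ ⟨τ, rfl⟩
    exact ⟨σ ++ τ, by rw [List.flatMap_append, WordSum.eval_append]⟩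
  smul_mem' := by
    rintro g _ ⟨σ, rfl⟩
    obtain ⟨P, rfl⟩ := WordSum.exists_eval_eq p g
    refine ⟨P.flatMap fun w => σ.map fun s => (w ++ s.1, s.2), ?_⟩
    rw [smul_eq_mul, List.flatMap_assoc, WordSum.eval_flatMap, WordSum.eval_flatMap,
      WordSum.eval, ← List.sum_map_mul_right]
    congr 1
    refine List.map_congr_left fun w _ => ?_
    rw [List.flatMap_map, WordSum.eval_flatMap, ← List.sum_map_mul_left]
    congr 1
    exact List.map_congr_left fun s _ => monomial_mul_eval_generator w s

variable {p}

theorem mem_relatorIdeal {f : FreeAlg (ZMod p)} : f ∈ relatorIdeal p ↔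
    ∃ σ : List (List (Fin 6) × List (Fin 6) × ℕ × ℕ × ℕ),
      f = WordSum.eval (ZMod p) (σ.flatMap (generator p)) := Iff.rfl

theorem eval_mem_relatorIdeal_iff (P : WordSum) : WordSum.eval (ZMod p) P ∈ relatorIdeal p ↔
    ∃ σ : List (List (Fin 6) × List (Fin 6) × ℕ × ℕ × ℕ),
      WordSum.Equiv p P (σ.flatMap (generator p)) := by
  simp only [WordSum.equiv_iff]
  exact mem_relatorIdeal

instance : (relatorIdeal p).IsTwoSided where
  mul_mem_of_left := by
    rintro _ g ⟨σ, rfl⟩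
    obtain ⟨P, rfl⟩ := WordSum.exists_eval_eq p g
    refine ⟨P.flatMap fun w => σ.map fun s => (s.1, s.2.1 ++ w, s.2.2), ?_⟩
    rw [List.flatMap_assoc, WordSum.eval_flatMap, WordSum.eval_flatMap,
      WordSum.eval, ← List.sum_map_mul_left]
    congr 1
    refine List.map_congr_left fun w _ => ?_
    rw [List.flatMap_map, WordSum.eval_flatMap, ← List.sum_map_mul_right]
    congr 1
    exact List.map_congr_left fun s _ => eval_generator_mul_monomial w s

/-- `S` is only a subspace because it will be a preimage under `component`, which need not be an
ideal. -/
theorem relatorIdeal_induction {S : Submodule (ZMod p) (FreeAlg (ZMod p))}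
    (h : ∀ u v q d, q < d → monomial (ZMod p) u * relator p q d * monomial (ZMod p) v ∈ S)
    {f : FreeAlg (ZMod p)} (hf : f ∈ relatorIdeal p) : f ∈ S := by
  obtain ⟨σ, rfl⟩ := hf
  rw [WordSum.eval_flatMap]
  refine list_sum_mem fun x hx => ?_
  obtain ⟨s, -, rfl⟩ := List.mem_map.1 hx
  by_cases hs : IsGeneratorIndex p s
  · rw [eval_generator_of_index hs]
    exact h _ _ _ _ hs.1
  · rw [eval_generator_of_not_index hs]
    exact zero_mem _

theorem relator_mem_relatorIdeal {q d : ℕ} (h : q < d) : relator p q d ∈ relatorIdeal p := by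
  by_cases ht : ∃ t, IsFirstCollision p q.unpair.1 t
  · obtain ⟨t, ht⟩ := ht
    refine ⟨[([], [], q, d, t)], ?_⟩
    rw [List.flatMap_singleton, eval_generator_of_index (s := ([], [], q, d, t)) ⟨h, ht⟩]
    simp [monomial_nil]
  · rw [relator, dif_neg ht]
    exact zero_mem _

theorem monomial_mul_relator_mul_monomial_mem_homog (u v : List (Fin 6)) (q d : ℕ) :
    monomial (ZMod p) u * relator p q d * monomial (ZMod p) v ∈
      homog (ZMod p) (u.length + d + v.length) :=
  mul_mem_homog (mul_mem_homog (monomial_mem_homog u) (relator_mem_homog q d))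
    (monomial_mem_homog v)

/-- Each generator is homogeneous, so `component` keeps or kills it. This links the enumerated ideal
to the one in the dimension count. -/
theorem component_mem_idealPart {f : FreeAlg (ZMod p)} (hf : f ∈ relatorIdeal p) (n : ℕ) :
    component (ZMod p) n f ∈ idealPart (relator p) n := by
  refine relatorIdeal_induction
    (S := (idealPart (relator p) n).comap (component (ZMod p) n)) (fun u v q d h => ?_) hf
  have h1 := monomial_mul_relator_mul_monomial_mem_homog (p := p) u v q d
  rw [Submodule.mem_comap]
  by_cases hn : u.length + d + v.length = n
  · rw [hn] at h1
    rw [component_eq_self h1, ← hn]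
    exact mul_monomial_mem_idealPart (mul_relator_mem_idealPart h (monomial_mem_homog u)) v
  · rw [component_eq_zero hn h1]
    exact zero_mem _

theorem component_mem_relatorIdeal {f : FreeAlg (ZMod p)} (hf : f ∈ relatorIdeal p) (n : ℕ) :
    component (ZMod p) n f ∈ relatorIdeal p := by
  refine relatorIdeal_induction (S := ((relatorIdeal p).restrictScalars (ZMod p)).comap
    (component (ZMod p) n)) (fun u v q d h => ?_) hf
  have h1 := monomial_mul_relator_mul_monomial_mem_homog (p := p) u v q d
  rw [Submodule.mem_comap, Submodule.restrictScalars_mem]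
  by_cases hn : u.length + d + v.length = n
  · rw [hn] at h1
    rw [component_eq_self h1]
    exact Ideal.mul_mem_right _ _ (Ideal.mul_mem_left _ _ (relator_mem_relatorIdeal h))
  · rw [component_eq_zero hn h1]
    exact zero_mem _

theorem exists_monomial_notMem_relatorIdeal (n : ℕ) :
    ∃ u : List (Fin 6), u.length = n ∧ ∀ f ∈ relatorIdeal p,
      component (ZMod p) n f ≠ monomial (ZMod p) u := by
  obtain ⟨u, hu, h⟩ := exists_monomial_notMem_idealPart (relator_mem_homog (p := p)) n
  exact ⟨u, hu, fun f hf he => h (he ▸ component_mem_idealPart hf n)⟩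

instance (n : ℕ) : Finite (homog (ZMod p) n) := Module.finite_of_finite (ZMod p)

/-- Pigeonhole: over a finite field there are finitely many `L`-tuples of truncated elements. The
larger of the two halting times serves as common step bound. -/
theorem exists_isCollision (c : Code) (f : ℕ → List WordSum)
    (hc : c.eval = fun i => Part.some (Encodable.encode (f i))) (L : ℕ) :
    ∃ t, IsCollision p (Nat.pair (Encodable.encode c) L) t := by
  set e := Nat.pair (Encodable.encode c) L with he
  obtain ⟨i, j, hij, heq⟩ := Finite.exists_ne_map_eq_of_infinite
    (fun (i : ℕ) (l : Fin L) (k : Fin (e.pair L + 1)) =>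
      (⟨component (ZMod p) k (WordSum.eval (ZMod p) ((f i).getD l [])),
        component_mem_homog _ _⟩ : homog (ZMod p) k))
  have hev : ∀ i, ∃ s, Encodable.encode (f i) ∈ c.evaln s i := fun i =>
    Code.evaln_complete.1 (by rw [hc]; exact Part.mem_some _)
  obtain ⟨s, hs⟩ := hev i
  obtain ⟨s', hs'⟩ := hev j
  have h1 := Code.evaln_mono (le_max_left s s') hs
  have h2 := Code.evaln_mono (le_max_right s s') hs'
  refine ⟨Nat.pair i (Nat.pair j (max s s')), ?_⟩
  simp only [IsCollision, output, Nat.unpair_pair, he, Denumerable.ofNat_encode]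
  rw [Option.mem_def] at h1 h2
  refine ⟨hij, by simp [h1], by simp [h2], fun l hl => ?_⟩
  rw [h1, h2, WordSum.equiv_iff, WordSum.eval_truncate, WordSum.eval_truncate]
  refine Finset.sum_congr rfl fun k hk => ?_
  have := congrFun (congrFun heq ⟨l, hl⟩) ⟨k, Finset.mem_range.1 hk⟩
  simpa using congrArg Subtype.val this

/-- Every computable sequence of tuples of elements of the quotient by the relator ideal repeats
itself. -/
theorem exists_collision {f : ℕ → List WordSum} (hf : Computable f) (L : ℕ) :
    ∃ i j, i ≠ j ∧ ∀ l < L, WordSum.eval (ZMod p) ((f i).getD l []) -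
      WordSum.eval (ZMod p) ((f j).getD l []) ∈ relatorIdeal p := by
  have h1 : Nat.Partrec fun i => Part.some (Encodable.encode (f i)) :=
    Partrec.nat_iff.1 (Computable.encode.comp hf).partrec
  obtain ⟨c, hc⟩ := Code.exists_code.1 h1
  obtain ⟨t, ht⟩ := exists_isFirstCollision (exists_isCollision (p := p) c f hc L)
  have hout : ∀ s i, (c.evaln s i).isSome → output (Encodable.encode c) s i = f i := by
    intro s i hi
    obtain ⟨x, hx⟩ := Option.isSome_iff_exists.1 hi
    have h2 := Code.evaln_sound (Option.mem_def.2 hx)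
    rw [hc, Part.mem_some_iff] at h2
    simp [output, hx, h2]
  have hcol := ht.1
  simp only [IsCollision, Nat.unpair_pair, Denumerable.ofNat_encode] at hcol
  obtain ⟨hij, hi, hj, hagree⟩ := hcol
  have hi' := hout _ _ hi
  have hj' := hout _ _ hj
  refine ⟨_, _, hij, fun l hl => ?_⟩
  set g := WordSum.eval (ZMod p) ((f t.unpair.1).getD l []) -
    WordSum.eval (ZMod p) ((f t.unpair.2.unpair.1).getD l []) with hg
  have hcomp : ∀ k, component (ZMod p) k g ∈ relatorIdeal p := by
    intro k
    set q := (Nat.pair (Encodable.encode c) L).pair l with hq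
    -- Above degree `q` the component is itself a relator. Up to degree `q`, which is below the
    -- cut-off as `l < L`, the outputs agree and the component vanishes.
    rcases lt_or_ge q k with hk | hk
    · have h3 := relator_mem_relatorIdeal (p := p) hk
      rw [relator_eq (t := t) (by rw [hq, Nat.unpair_pair]; exact ht),
        eval_collisionRelator] at h3
      simpa only [hq, Nat.unpair_pair, hi', hj'] using h3
    · have h3 := hagree l hl
      rw [hi', hj', WordSum.equiv_iff, WordSum.eval_truncate, WordSum.eval_truncate,
        ← sub_eq_zero, ← Finset.sum_sub_distrib] at h3
      simp only [← map_sub] at h3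
      rw [← hg] at h3
      have h4 := congrArg (component (ZMod p) k) h3
      rw [map_sum, map_zero, Finset.sum_eq_single k] at h4
      · rw [component_eq_self (component_mem_homog k g)] at h4
        rw [h4]
        exact zero_mem _
      · exact fun m _ hm => component_eq_zero hm (component_mem_homog m g)
      · intro hk'
        have := Nat.pair_lt_pair_right (Nat.pair (Encodable.encode c) L) hl
        simp at hk'
        omega
  obtain ⟨N, hN⟩ := exists_sum_component g
  rw [hN N le_rfl]
  exact sum_mem fun k _ => hcomp k

end RelatorIdeal

/-! ### The quotient algebra: infinitude, nilpotent letters, degree filtration. -/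

section ResidualFilter

variable {p : ℕ} [Fact p.Prime]

/-- Left multiplication by a word shifts degrees upwards (`key`). This makes `filtration` a left
ideal, which is enough for a group acting by left multiplication. -/
theorem component_mul_mem_relatorIdeal {n : ℕ} {f : FreeAlg (ZMod p)}
    (hf : ∀ k < n, component (ZMod p) k f ∈ relatorIdeal p) (g : FreeAlg (ZMod p)) :
    ∀ k < n, component (ZMod p) k (g * f) ∈ relatorIdeal p := by
  have key : ∀ (u : List (Fin 6)) (k : ℕ) (f : FreeAlg (ZMod p)),
      component (ZMod p) k (monomial (ZMod p) u * f) =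
        if u.length ≤ k then monomial (ZMod p) u * component (ZMod p) (k - u.length) f else 0 := by
    intro u k f
    have hf : f ∈ Submodule.span (ZMod p) (Set.range (monomial (ZMod p))) := by
      simp [span_monomial]
    induction hf using Submodule.span_induction with
    | mem x hx =>
      obtain ⟨v, rfl⟩ := hx
      rw [← monomial_append, component_monomial, component_monomial, List.length_append,
        monomial_append, mul_ite, mul_zero]
      split_ifs <;> first | rfl | omega
    | zero => simp
    | add f g _ _ hf hg => rw [mul_add, map_add, hf, hg]; split_ifs <;> simp [mul_add]
    | smul a f _ hf => rw [mul_smul_comm, map_smul, hf]; split_ifs <;> simp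
  have hg : g ∈ Submodule.span (ZMod p) (Set.range (monomial (ZMod p))) := by
    simp [span_monomial]
  intro k hk
  induction hg using Submodule.span_induction with
  | mem x hx =>
    obtain ⟨u, rfl⟩ := hx
    rw [key]
    split_ifs
    · exact Ideal.mul_mem_left _ _ (hf _ (by omega))
    · exact zero_mem _
  | zero => simp
  | add f g _ _ hf hg => rw [add_mul, map_add]; exact add_mem hf hg
  | smul a f _ hf =>
    rw [smul_mul_assoc, map_smul]
    exact Submodule.smul_of_tower_mem (relatorIdeal p) a hf

variable (p)

/-- The quotient of the free algebra by the ideal of all relations. -/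
abbrev QuotAlg : Type := FreeAlg (ZMod p) ⧸ relatorIdeal p

variable {p}

/-- The class of a sum of words in the quotient algebra. -/
noncomputable def quotEval (P : WordSum) : QuotAlg p :=
  Ideal.Quotient.mk (relatorIdeal p) (WordSum.eval (ZMod p) P)

theorem quotEval_append (P Q : WordSum) :
    quotEval (p := p) (P ++ Q) = quotEval P + quotEval Q := by
  rw [quotEval, WordSum.eval_append, map_add]; rfl

theorem quotEval_mul (P Q : WordSum) : quotEval (p := p) (P.mul Q) = quotEval P * quotEval Q := by
  rw [quotEval, WordSum.eval_mul, map_mul]; rfl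

theorem quotEval_neg (P : WordSum) : quotEval (p := p) (P.neg p) = -quotEval P := by
  rw [quotEval, WordSum.eval_neg, map_neg]; rfl

theorem quotEval_nil : quotEval (p := p) [] = 0 := by
  rw [quotEval, WordSum.eval_nil, map_zero]

theorem quotEval_one : quotEval (p := p) [[]] = 1 := by
  rw [quotEval, WordSum.eval_singleton, monomial_nil, map_one]

theorem quotEval_surjective : Function.Surjective (quotEval (p := p)) := fun a => by
  obtain ⟨f, rfl⟩ := Ideal.Quotient.mk_surjective a
  obtain ⟨P, rfl⟩ := WordSum.exists_eval_eq p f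
  exact ⟨P, rfl⟩

theorem quotEval_eq_zero_iff (P : WordSum) : quotEval (p := p) P = 0 ↔
    ∃ σ : List (List (Fin 6) × List (Fin 6) × ℕ × ℕ × ℕ),
      WordSum.Equiv p P (σ.flatMap (generator p)) := by
  rw [quotEval, Ideal.Quotient.eq_zero_iff_mem, eval_mem_relatorIdeal_iff]

theorem exists_quotEval_collision {f : ℕ → List WordSum} (hf : Computable f) (L : ℕ) :
    ∃ i j, i ≠ j ∧ ∀ l < L,
      quotEval (p := p) ((f i).getD l []) = quotEval ((f j).getD l []) := by
  obtain ⟨i, j, hij, h⟩ := exists_collision (p := p) hf L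
  exact ⟨i, j, hij, fun l hl => Ideal.Quotient.eq.2 (h l hl)⟩

instance : Countable (QuotAlg p) := quotEval_surjective.countable

/-- Choose a surviving word in each degree. If two of them became equal, one would be a component of
an element of the ideal. -/
instance : Infinite (QuotAlg p) := by
  choose u hu h using exists_monomial_notMem_relatorIdeal (p := p)
  refine Infinite.of_injective (fun n : ℕ => quotEval (p := p) [u n]) fun m n hmn => ?_
  by_contra hne
  have h1 := Ideal.Quotient.eq.1 hmn
  rw [WordSum.eval_singleton, WordSum.eval_singleton] at h1
  refine h m _ h1 ?_
  rw [map_sub, component_monomial, component_monomial, if_pos (hu m), hu n, if_neg (Ne.symm hne),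
    sub_zero]

/-- The powers of a letter form a computable sequence, so the difference of two of them lies in the
ideal; by homogeneity each power does. -/
theorem isNilpotent_letter (i : Fin 6) : IsNilpotent (quotEval (p := p) [[i]]) := by
  have hcomp : Computable fun n : ℕ => [[(List.range n).map fun _ => i]] := by
    have h1 : Primrec fun n : ℕ => (List.range n).map fun _ => i :=
      Primrec.list_map Primrec.list_range (Primrec.const i)
    exact (Primrec.list_cons.comp (Primrec.list_cons.comp h1 (Primrec.const []))
      (Primrec.const [])).to_comp
  obtain ⟨m, n, hmn, h⟩ := exists_collision (p := p) (f := fun n => [[(List.range n).map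
    fun _ => i]]) hcomp 1
  have hpow : ∀ n, quotEval (p := p) [[i]] ^ n =
      quotEval (p := p) [(List.range n).map fun _ => i] := by
    intro n
    induction n with
    | zero => rw [pow_zero, ← quotEval_one]; rfl
    | succ n ih =>
      rw [pow_succ, ih, ← quotEval_mul, List.range_succ, List.map_append]
      rfl
  have h1 := component_mem_relatorIdeal (h 0 one_pos) m
  simp only [List.getD_cons_zero, WordSum.eval_singleton, map_sub, component_monomial,
    List.length_map, List.length_range, if_true, if_neg hmn.symm, sub_zero] at h1
  refine ⟨m, ?_⟩
  rw [hpow, quotEval, WordSum.eval_singleton, Ideal.Quotient.eq_zero_iff_mem]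
  exact h1

/-- The classes of the elements without terms of degree less than `n` form a left ideal. -/
noncomputable def filtration (n : ℕ) : Ideal (QuotAlg p) where
  carrier := {a | ∃ f, Ideal.Quotient.mk (relatorIdeal p) f = a ∧
    ∀ k < n, component (ZMod p) k f ∈ relatorIdeal p}
  zero_mem' := ⟨0, map_zero _, by simp⟩
  add_mem' := by
    rintro _ _ ⟨f, rfl, hf⟩ ⟨g, rfl, hg⟩
    exact ⟨f + g, map_add _ _ _, fun k hk => by
      rw [map_add]; exact add_mem (hf k hk) (hg k hk)⟩
  smul_mem' := by
    rintro b _ ⟨f, rfl, hf⟩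
    obtain ⟨g, rfl⟩ := Ideal.Quotient.mk_surjective b
    exact ⟨g * f, map_mul _ _ _, component_mul_mem_relatorIdeal hf g⟩

/-- Homogeneity of the ideal makes the condition independent of the representative. -/
theorem mk_mem_filtration_iff (n : ℕ) (f : FreeAlg (ZMod p)) :
    Ideal.Quotient.mk (relatorIdeal p) f ∈ filtration n ↔
      ∀ k < n, component (ZMod p) k f ∈ relatorIdeal p := by
  refine ⟨fun ⟨g, hg, h⟩ k hk => ?_, fun h => ⟨f, rfl, h⟩⟩
  have h1 := component_mem_relatorIdeal (Ideal.Quotient.eq.1 hg) k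
  rw [map_sub] at h1
  exact (Submodule.sub_mem_iff_right _ (h k hk)).1 h1

theorem eq_zero_of_forall_mem_filtration {a : QuotAlg p} (h : ∀ n, a ∈ filtration n) : a = 0 := by
  obtain ⟨f, rfl⟩ := Ideal.Quotient.mk_surjective a
  rw [Ideal.Quotient.eq_zero_iff_mem]
  obtain ⟨N, hN⟩ := exists_sum_component f
  rw [hN N le_rfl]
  exact sum_mem fun k hk => (mk_mem_filtration_iff N f).1 (h N) k (Finset.mem_range.1 hk)

instance (n : ℕ) : Finite (QuotAlg p ⧸ filtration (p := p) n) := by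
  refine Finite.of_surjective (fun x : (k : Fin n) → homog (ZMod p) k =>
    Submodule.Quotient.mk (p := filtration (p := p) n)
      (Ideal.Quotient.mk (relatorIdeal p) (∑ k, (x k : FreeAlg (ZMod p))))) fun y => ?_
  obtain ⟨a, rfl⟩ := Submodule.Quotient.mk_surjective _ y
  obtain ⟨f, rfl⟩ := Ideal.Quotient.mk_surjective a
  refine ⟨fun k => ⟨component (ZMod p) k f, component_mem_homog _ _⟩, ?_⟩
  rw [Submodule.Quotient.eq, ← map_sub, mk_mem_filtration_iff]
  intro k hk
  rw [map_sub, map_sum, Finset.sum_eq_single (⟨k, hk⟩ : Fin n)]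
  · rw [component_eq_self (component_mem_homog k f), sub_self]
    exact zero_mem _
  · exact fun j _ hj => component_eq_zero (fun h => hj (Fin.ext h)) (component_mem_homog _ f)
  · simp

end ResidualFilter

/-! ### The affine group over the quotient algebra. -/

section TheGroup

variable {p : ℕ} [Fact p.Prime]

/-- The unit `1 + x i` of the quotient algebra. -/
noncomputable def letterUnit (i : Fin 6) : (QuotAlg p)ˣ :=
  (isNilpotent_letter i).isUnit_one_add.unit

variable (p)

/-- The group generated by the units `1 + x i`. -/
noncomputable def unitGroup : Subgroup (QuotAlg p)ˣ :=
  Subgroup.closure (Set.range letterUnit)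

/-- The action of the unit group on the additive group of the algebra by left multiplication. -/
noncomputable def unitGroupAction : unitGroup p →* MulAut (Multiplicative (QuotAlg p)) where
  toFun h := AddEquiv.toMultiplicative (DistribMulAction.toAddEquiv (QuotAlg p) h)
  map_one' := by
    ext a
    exact congrArg Multiplicative.ofAdd (one_smul (unitGroup p) a.toAdd)
  map_mul' h k := by
    ext a
    exact congrArg Multiplicative.ofAdd (mul_smul h k a.toAdd)

/-- The group of all affine maps `x ↦ a + h * x` of the algebra with `h` in the unit group. -/
abbrev AffineGroup : Type := Multiplicative (QuotAlg p) ⋊[unitGroupAction p] unitGroup p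

variable {p}

namespace AffineGroup

/-- The translation part. -/
def trans (x : AffineGroup p) : QuotAlg p := x.left.toAdd

/-- The linear part. -/
def lin (x : AffineGroup p) : QuotAlg p := (x.right : (QuotAlg p)ˣ)

theorem trans_one : trans (1 : AffineGroup p) = 0 := rfl

theorem lin_one : lin (1 : AffineGroup p) = 1 := rfl

theorem trans_mul (x y : AffineGroup p) : (x * y).trans = x.trans + x.lin * y.trans := rfl

theorem lin_mul (x y : AffineGroup p) : (x * y).lin = x.lin * y.lin := rfl

theorem ext_iff' {x y : AffineGroup p} : x = y ↔ x.trans = y.trans ∧ x.lin = y.lin :=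
  ⟨fun h => h ▸ ⟨rfl, rfl⟩, fun h => SemidirectProduct.ext h.1 (Subtype.ext (Units.ext h.2))⟩

instance : Infinite (AffineGroup p) :=
  Infinite.of_injective _ (SemidirectProduct.inl_injective (φ := unitGroupAction p))

variable (p) in
/-- The generators: the translation by `1` and the multiplications by the units `1 + x i`. -/
noncomputable def gen : Fin 7 → AffineGroup p :=
  Fin.cons (SemidirectProduct.inl (Multiplicative.ofAdd 1)) fun i : Fin 6 =>
    SemidirectProduct.inr ⟨letterUnit i, Subgroup.subset_closure ⟨i, rfl⟩⟩

/-- The commutator of `1 + x i` with the translation by `a` is the translation by `x i * a`.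
Starting from `1`, this yields the translations by all words, then by all sums of words. -/
theorem closure_range_gen : Subgroup.closure (Set.range (gen p)) = ⊤ := by
  set S := Subgroup.closure (Set.range (gen p)) with hS
  have hinr : ∀ h, (SemidirectProduct.inr h : AffineGroup p) ∈ S := by
    rintro ⟨h, hh⟩
    induction hh using Subgroup.closure_induction with
    | mem x hx =>
      obtain ⟨i, rfl⟩ := hx
      exact Subgroup.subset_closure ⟨i.succ, by simp [gen]⟩
    | one => exact one_mem S
    | mul x y hx hy h1 h2 =>
      have h3 := mul_mem h1 h2
      rw [← map_mul] at h3
      exact h3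
    | inv x hx h1 =>
      have h3 := inv_mem h1
      rw [← map_inv] at h3
      exact h3
  have hsmul : ∀ (i : Fin 6) (a : QuotAlg p),
      (SemidirectProduct.inl (Multiplicative.ofAdd a) : AffineGroup p) ∈ S →
      (SemidirectProduct.inl (Multiplicative.ofAdd (quotEval [[i]] * a)) : AffineGroup p) ∈ S := by
    intro i a ha
    set h : unitGroup p := ⟨letterUnit i, Subgroup.subset_closure ⟨i, rfl⟩⟩ with hh
    have h1 := mul_mem (mul_mem (mul_mem (hinr h) ha) (hinr h⁻¹)) (inv_mem ha)
    rw [← SemidirectProduct.inl_aut, ← map_inv, ← map_mul] at h1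
    convert h1 using 2
    have h2 : unitGroupAction p h (Multiplicative.ofAdd a) =
      Multiplicative.ofAdd ((1 + quotEval [[i]]) * a) := rfl
    rw [h2, ← ofAdd_neg, ← ofAdd_add, add_mul, one_mul, add_neg_cancel_comm]
  have hmono : ∀ u : List (Fin 6),
      (SemidirectProduct.inl (Multiplicative.ofAdd (quotEval [u])) : AffineGroup p) ∈ S := by
    intro u
    induction u with
    | nil => exact Subgroup.subset_closure ⟨0, by rw [quotEval_one]; rfl⟩
    | cons i u ih =>
      have h1 := hsmul i _ ih
      rwa [← quotEval_mul] at h1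
  have hinl : ∀ a, (SemidirectProduct.inl (Multiplicative.ofAdd a) : AffineGroup p) ∈ S := by
    intro a
    obtain ⟨P, rfl⟩ := quotEval_surjective a
    induction P with
    | nil => rw [quotEval_nil, ofAdd_zero, map_one]; exact one_mem S
    | cons u P ih =>
      rw [show u :: P = [u] ++ P from rfl, quotEval_append, ofAdd_add, map_mul]
      exact mul_mem (hmono u) ih
  rw [eq_top_iff]
  rintro x -
  rw [← SemidirectProduct.inl_left_mul_inr_right x]
  exact mul_mem (hinl _) (hinr _)

instance : Group.FG (AffineGroup p) :=
  Group.fg_iff.2 ⟨_, closure_range_gen, Set.finite_range _⟩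

theorem wordValue_cons {G : Type*} [Group G] {k : ℕ} (g : Fin k → G) (x : Fin k × Bool)
    (w : List (Fin k × Bool)) :
    wordValue g (x :: w) = wordValue g [x] * wordValue g w := by
  simp [wordValue]

/-- The coordinates of the value of a word are primitive recursive. -/
theorem exists_primrec_coordinates {k : ℕ} (g : Fin k → AffineGroup p) :
    ∃ c : List (Fin k × Bool) → WordSum × WordSum, Primrec c ∧ ∀ w,
      quotEval (c w).1 = (wordValue g w).trans ∧ quotEval (c w).2 = (wordValue g w).lin := by
  -- The representatives are chosen without an algorithm, but for finitely many letters only, so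
  -- they form a finite table.
  choose a ha using fun x => quotEval_surjective (wordValue g [x]).trans
  choose h hh using fun x => quotEval_surjective (wordValue g [x]).lin
  refine ⟨fun w => w.foldr (fun x c => (a x ++ (h x).mul c.1, (h x).mul c.2)) ([], [[]]), ?_, ?_⟩
  · have h1 : Primrec fun z : List (Fin k × Bool) × (Fin k × Bool) × WordSum × WordSum =>
        a z.2.1 := (Primrec.dom_finite a).comp (Primrec.fst.comp Primrec.snd)
    have h2 : Primrec fun z : List (Fin k × Bool) × (Fin k × Bool) × WordSum × WordSum =>
        h z.2.1 := (Primrec.dom_finite h).comp (Primrec.fst.comp Primrec.snd)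
    have h3 : Primrec fun z : List (Fin k × Bool) × (Fin k × Bool) × WordSum × WordSum =>
        z.2.2 := Primrec.snd.comp Primrec.snd
    exact Primrec.list_foldr Primrec.id (Primrec.const _)
      (Primrec.to₂ <| (Primrec.list_append.comp h1 (primrec_mul.comp h2 (Primrec.fst.comp h3))).pair
        (primrec_mul.comp h2 (Primrec.snd.comp h3)))
  · intro w
    induction w with
    | nil => exact ⟨quotEval_nil, quotEval_one⟩
    | cons x w ih =>
      dsimp only at ih ⊢
      rw [List.foldr_cons, wordValue_cons, trans_mul, lin_mul, quotEval_append, quotEval_mul,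
        quotEval_mul, ih.1, ih.2, ha, hh]
      exact ⟨rfl, rfl⟩

theorem wordValue_apply {n k : ℕ} {G : Type*} [Group G] (g : Fin k → Fin n → G)
    (w : List (Fin k × Bool)) (j : Fin n) :
    wordValue g w j = wordValue (fun a => g a j) w := by
  have h : (Pi.evalMonoidHom (fun _ : Fin n => G) j).comp (FreeGroup.lift g) =
      FreeGroup.lift fun a => g a j := by
    ext a
    simp
  exact DFunLike.congr_fun h (FreeGroup.mk w)

/-- The `n` translation parts followed by the `n` linear parts form one tuple of length `n + n`; a
collision of tuples is an equality in the power. -/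
theorem algorithmicallyFinite_pi (n : ℕ) : AlgorithmicallyFinite (Fin n → AffineGroup p) := by
  refine ⟨inferInstance, ?_⟩
  rintro k g - ⟨f, hf, hinj⟩
  choose c hc hcw using fun j : Fin n => exists_primrec_coordinates fun a => g a j
  have hF : Primrec fun w : List (Fin k × Bool) =>
      List.ofFn (Fin.append (fun j => (c j w).1) fun j => (c j w).2) := by
    refine Primrec.list_ofFn
      (f := fun i w => Fin.append (fun j => (c j w).1) (fun j => (c j w).2) i) fun i => ?_
    refine Fin.addCases (fun j => ?_) (fun j => ?_) i
    · simp only [Fin.append_left]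
      exact Primrec.fst.comp (hc j)
    · simp only [Fin.append_right]
      exact Primrec.snd.comp (hc j)
  obtain ⟨i, j, hij, h⟩ := exists_quotEval_collision (p := p) (hF.to_comp.comp hf) (n + n)
  refine hij (hinj (funext fun l => ?_))
  simp only [wordValue_apply]
  rw [ext_iff', ← (hcw l _).1, ← (hcw l _).2, ← (hcw l _).1, ← (hcw l _).2]
  have h' : ∀ m : Fin (n + n),
      quotEval (p := p) (Fin.append (fun j => (c j (f i)).1) (fun j => (c j (f i)).2) m) =
      quotEval (Fin.append (fun l => (c l (f j)).1) (fun l => (c l (f j)).2) m) := by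
    intro m
    have h1 := h m m.2
    rwa [List.getD_eq_getElem _ _ (by simp), List.getD_eq_getElem _ _ (by simp),
      List.getElem_ofFn, List.getElem_ofFn] at h1
  have h1 := h' (Fin.castAdd n l)
  have h2 := h' (Fin.natAdd n l)
  rw [Fin.append_left, Fin.append_left] at h1
  rw [Fin.append_right, Fin.append_right] at h2
  exact ⟨h1, h2⟩

/-- All trivial words serve as relators. A word is trivial iff its translation part and its linear
part minus `1` vanish in the quotient, which two lists of generators witness. -/
theorem isRecursivelyPresented : IsRecursivelyPresented (AffineGroup p) := by
  refine ⟨7, {w | wordValue (gen p) w = 1}, ?_, ?_⟩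
  · obtain ⟨c, hc, hcw⟩ := exists_primrec_coordinates (gen p)
    have h1 := primrecRel_equiv_flatMap_generator p
    have h2 : PrimrecRel fun (w : List (Fin 7 × Bool))
        (σ : List (List (Fin 6) × List (Fin 6) × ℕ × ℕ × ℕ) ×
          List (List (Fin 6) × List (Fin 6) × ℕ × ℕ × ℕ)) =>
        WordSum.Equiv p (c w).1 (σ.1.flatMap (generator p)) ∧
        WordSum.Equiv p ((c w).2 ++ WordSum.neg p [[]]) (σ.2.flatMap (generator p)) :=
      (h1.comp (Primrec.fst.comp (hc.comp Primrec.fst)) (Primrec.fst.comp Primrec.snd)).and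
        (h1.comp (Primrec.list_append.comp (Primrec.snd.comp (hc.comp Primrec.fst))
          (Primrec.const _)) (Primrec.snd.comp Primrec.snd))
    refine h2.rePred_exists.of_eq fun w => ?_
    rw [Prod.exists]
    simp only [exists_and_left, exists_and_right]
    rw [← quotEval_eq_zero_iff, ← quotEval_eq_zero_iff, quotEval_append, quotEval_neg,
      quotEval_one, ← sub_eq_add_neg, sub_eq_zero, (hcw w).1, (hcw w).2, Set.mem_ofPred_eq,
      ext_iff', trans_one, lin_one]
  · have hsurj : Function.Surjective (FreeGroup.lift (gen p)) := by
      rw [← MonoidHom.range_eq_top, FreeGroup.range_lift_eq_closure, closure_range_gen]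
    have hker : Subgroup.normalClosure (FreeGroup.mk '' {w | wordValue (gen p) w = 1}) =
        (FreeGroup.lift (gen p)).ker := by
      have h : FreeGroup.mk '' {w | wordValue (gen p) w = 1} =
          ((FreeGroup.lift (gen p)).ker : Set (FreeGroup (Fin 7))) := by
        ext x
        constructor
        · rintro ⟨w, hw, rfl⟩
          exact hw
        · intro hx
          exact ⟨x.toWord, (congrArg _ FreeGroup.mk_toWord).trans hx,
            FreeGroup.mk_toWord⟩
      rw [h, Subgroup.normalClosure_eq_self]
    exact ⟨(QuotientGroup.quotientMulEquivOfEq hker).trans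
      (QuotientGroup.quotientKerEquivOfSurjective _ hsurj)⟩

/-- The affine action on the quotient by a step of the filtration. -/
noncomputable def affineAction (n : ℕ) :
    AffineGroup p →* Function.End (QuotAlg p ⧸ filtration (p := p) n) where
  toFun x := fun y => Submodule.Quotient.mk x.trans + x.lin • y
  map_one' := by
    funext y
    rw [trans_one, lin_one, one_smul, Submodule.Quotient.mk_zero, zero_add]
    rfl
  map_mul' x z := by
    funext y
    change _ = Submodule.Quotient.mk x.trans +
      x.lin • (Submodule.Quotient.mk z.trans + z.lin • y)
    rw [trans_mul, lin_mul, smul_add, mul_smul, ← Submodule.Quotient.mk_smul, ← add_assoc,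
      ← Submodule.Quotient.mk_add, smul_eq_mul]

/-- An affine map is determined by its values at `0` and `1`, and these are detected by the finite
quotients by the filtration. -/
instance : Group.ResiduallyFinite (AffineGroup p) := by
  rw [Group.residuallyFinite_iff_forall_finiteIndex]
  intro x hx
  have key : ∀ n (y : QuotAlg p), x.trans + x.lin * y - y ∈ filtration (p := p) n := by
    intro n y
    have h1 := MonoidHom.mem_ker.1 (hx (affineAction (p := p) n).toHomPerm.ker)
    have h2 := Equiv.congr_fun h1 (Submodule.Quotient.mk y)
    exact (Submodule.Quotient.eq _).1 h2
  have h0 : x.trans = 0 := eq_zero_of_forall_mem_filtration fun n => by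
    simpa using key n 0
  have h1 : x.lin - 1 = 0 := eq_zero_of_forall_mem_filtration fun n => by
    simpa [h0] using key n 1
  exact ext_iff'.2 ⟨h0, sub_eq_zero.1 h1⟩

theorem isComplement'_range : Subgroup.IsComplement'
    (SemidirectProduct.inl (φ := unitGroupAction p)).range
    (SemidirectProduct.inr (φ := unitGroupAction p)).range := by
  refine Subgroup.isComplement'_of_disjoint_and_mul_eq_univ ?_ ?_
  · rw [Subgroup.disjoint_def]
    rintro _ ⟨a, rfl⟩ ⟨h, hh⟩
    have := congrArg SemidirectProduct.right hh
    rw [SemidirectProduct.right_inl, SemidirectProduct.right_inr] at this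
    rw [← hh, this, map_one]
  · refine Set.eq_univ_of_forall fun x => ?_
    exact ⟨_, ⟨x.left, rfl⟩, _, ⟨x.right, rfl⟩, SemidirectProduct.inl_left_mul_inr_right x⟩

/-- A basis is countable as part of a countable algebra, and infinite since a finite one over `ZMod
p` would span a finite space. -/
theorem nonempty_addEquiv_finsupp : Nonempty (QuotAlg p ≃+ (ℕ →₀ ZMod p)) := by
  let b := Module.Basis.ofVectorSpace (ZMod p) (QuotAlg p)
  have hinf : Infinite (Module.Basis.ofVectorSpaceIndex (ZMod p) (QuotAlg p)) := by
    by_contra hfin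
    rw [not_infinite_iff_finite] at hfin
    have := Module.Finite.of_basis b
    have := Module.finite_of_finite (ZMod p) (M := QuotAlg p)
    exact not_finite (QuotAlg p)
  obtain ⟨hd⟩ := nonempty_denumerable (Module.Basis.ofVectorSpaceIndex (ZMod p) (QuotAlg p))
  exact ⟨(b.repr.trans (Finsupp.domLCongr (Denumerable.eqv _))).toAddEquiv⟩

end AffineGroup

end TheGroup

theorem mainTheorem1 :
    (∃ (G : Type) (_ : Group G),
      Infinite G ∧ Group.FG G ∧ IsRecursivelyPresented G ∧ Group.ResiduallyFinite G ∧
        ∀ n : ℕ, 0 < n → AlgorithmicallyFinite (Fin n → G)) ∧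
    (∀ p : ℕ, p.Prime →
      ∃ (G : Type) (_ : Group G),
        (Infinite G ∧ Group.FG G ∧ IsRecursivelyPresented G ∧ Group.ResiduallyFinite G ∧
          ∀ n : ℕ, 0 < n → AlgorithmicallyFinite (Fin n → G)) ∧
        ∃ N H : Subgroup G, N.Normal ∧ Subgroup.IsComplement' N H ∧
          Nonempty (N ≃* Multiplicative (ℕ →₀ ZMod p))) := by
  have main : ∀ (p : ℕ) [Fact p.Prime], Infinite (AffineGroup p) ∧ Group.FG (AffineGroup p) ∧
      IsRecursivelyPresented (AffineGroup p) ∧ Group.ResiduallyFinite (AffineGroup p) ∧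
        ∀ n : ℕ, 0 < n → AlgorithmicallyFinite (Fin n → AffineGroup p) := fun p _ =>
    ⟨inferInstance, inferInstance, AffineGroup.isRecursivelyPresented, inferInstance,
      fun n _ => AffineGroup.algorithmicallyFinite_pi n⟩
  refine ⟨?_, fun p hp => ?_⟩
  · have : Fact (Nat.Prime 2) := ⟨Nat.prime_two⟩
    exact ⟨AffineGroup 2, inferInstance, main 2⟩
  · have : Fact p.Prime := ⟨hp⟩
    obtain ⟨e⟩ := AffineGroup.nonempty_addEquiv_finsupp (p := p)
    refine ⟨AffineGroup p, inferInstance, main p, _, _, ?_, AffineGroup.isComplement'_range,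
      ⟨(MonoidHom.ofInjective SemidirectProduct.inl_injective).symm.trans
        (AddEquiv.toMultiplicative e)⟩⟩
    rw [SemidirectProduct.range_inl_eq_ker_rightHom]
    infer_instance
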